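/- Theorem 4.1 ($SDP_0$ bound). Let $\mathbf M$ be a compact metric space with distance $\rho$ on which a group $G$ acts by isometries so that whenever $\rho(x,y)=\rho(x',y')$ there is $g\in G$ with $gx=x'$, $gy=y'$ (a compact 2-point-homogeneous space; finite spaces are included), and let $\mu$ be its $G$-invariant Borel probability measure. Let $\tau(x,y)=F(\rho(x,y))$ for a function $F:\mathbf R\to\mathbf R$, $\tau_0=F(0)=\tau(x,x)$, and $T=\{\tau(x,y):x,y\in\mathbf M\}$. Let $I=\{k\in\mathbf Z_{\ge0}: k<|T|\}$ (so $I=\{0,1,2,\dots\}$ if $T$ is infinite). Let $\Phi_k$, $k\in I$, be the zonal spherical functions of $\mathbf M$, assumed to be polynomials of degree $k$ in $\tau$: there is an orthogonal decomposition $L^2(\mathbf M,\mu)=\bigoplus_{k\in I}V_k$ of the space of complex square-integrable functions into irreducible $G$-invariant finite-dimensional spaces $V_k$ of continuous functions, and for each $k\in I$, $$\Phi_k(t)=p_{k0}+p_{k1}t+\dots+p_{kk}t^k$$ is a real polynomial of degree $k$ with $\Phi_k(\tau_0)=1$ such that for every $y\in\mathbf M$ the function $x\mapsto\Phi_k(\tau(x,y))$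 belongs to $V_k$. Let $a,b$ be real numbers and $S=T\cap[a,b]$. An $S$-code is a finite set $C\subset\mathbf M$ with $\tau(x,y)\in S$ for all distinct $x,y\in C$, and $A(\mathbf M,S)$ is the largest cardinality of an $S$-code. Let $m\ge1$ be an integer. For real $x_1,\dots,x_{2m-1}$ put $x_0=1$ and let $\bar H_m(x_1,\dots,x_{2m-1},[a,b])$ be the block diagonal matrix with the three $m\times m$ blocks $$(x_{i+j})_{0\le i,j<m},\qquad (x_{i+j+1}-a\,x_{i+j})_{0\le i,j<m},\qquad (b\,x_{i+j}-x_{i+j+1})_{0\le i,j<m}.$$ The $SDP_0$ problem is to minimize $y$ over all real $y,x_1,\dots,x_{2m-1}$ subject to $$y+\sum_{i=1}^k p_{ki}x_i\ge -p_{k0}\quad (1\le k\le 2m-1,\ k\in I),\qquad \bar H_m(x_1,\dots,x_{2m-1},[a,b])\succeq0.$$ Let the real number $y^*$ be its optimal value (the infimum, whether attained or not), and suppose that $y^*>0$. Then $$A(\mathbf M,S)\le\frac{1+y^*}{y^*};$$ in particular $A(\mathbf M,S)$ is finite. -/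

import Mathlib

open MeasureTheory
open scoped ENNReal

namespace TwoPointCodes

/-- The group `G` acts on the metric space `M` by isometries, and any two pairs of points at the same
distance are related by an element of `G`: `M` is a 2-point-homogeneous `G`-space. -/
structure IsTwoPointHomogeneous (G M : Type*) [MetricSpace M] [Group G] [MulAction G M] : Prop where
  isometric : ∀ (g : G) (x y : M), dist (g • x) (g • y) = dist x y
  homogeneous : ∀ x y x' y' : M, dist x y = dist x' y' → ∃ g : G, g • x = x' ∧ g • y = y'

/-- The function `τ(x,y) = F(ρ(x,y))` of the distance. -/
def tau {M : Type*} [MetricSpace M] (F : ℝ → ℝ) (x y : M) : ℝ := F (dist x y)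

/-- The set `T = {τ(x,y) : x, y ∈ M}`. -/
def tauRange (M : Type*) [MetricSpace M] (F : ℝ → ℝ) : Set ℝ :=
  {t | ∃ x y : M, tau F x y = t}

/-- The indices `k` of the zonal spherical functions `Φ_k`: all natural numbers if `T` is infinite, and
`0, …, |T| - 1` if `T` is finite. -/
def zonalIndex (M : Type*) [MetricSpace M] (F : ℝ → ℝ) : Set ℕ :=
  {k | (k : ℕ∞) < (tauRange M F).encard}

/-- A space of complex functions on `M` that is stable under all translations by elements of `G`. -/
def IsInvariantSpace (G : Type*) {M : Type*} [Group G] [MulAction G M]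
    (W : Submodule ℂ (M → ℂ)) : Prop :=
  ∀ g : G, ∀ f ∈ W, (fun x => f (g • x)) ∈ W

/-- A decomposition `L²(M, μ) = ⨁ V_k`, `k ∈ I`, into pairwise orthogonal irreducible `G`-invariant
finite-dimensional spaces (of continuous functions). -/
structure IsHarmonicDecomposition (G : Type*) {M : Type*} [MetricSpace M] [MeasurableSpace M]
    [Group G] [MulAction G M] (μ : Measure M) (I : Set ℕ) (V : ℕ → Submodule ℂ (M → ℂ)) :
    Prop where
  finite : ∀ k ∈ I, Module.Finite ℂ (V k)
  continuous : ∀ k ∈ I, ∀ f ∈ V k, Continuous f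
  invariant : ∀ k ∈ I, IsInvariantSpace G (V k)
  nontrivial : ∀ k ∈ I, V k ≠ ⊥
  irreducible : ∀ k ∈ I, ∀ W : Submodule ℂ (M → ℂ), W ≤ V k → IsInvariantSpace G W →
    W = ⊥ ∨ W = V k
  orthogonal : ∀ k ∈ I, ∀ l ∈ I, k ≠ l → ∀ f ∈ V k, ∀ g ∈ V l,
    ∫ x, f x * (starRingEnd ℂ) (g x) ∂μ = 0
  complete : ∀ f : M → ℂ, MemLp f 2 μ →
    (∀ k ∈ I, ∀ g ∈ V k, ∫ x, f x * (starRingEnd ℂ) (g x) ∂μ = 0) → f =ᵐ[μ] 0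

/-- The real polynomials `Φ_k`, `k = 0, 1, …`, are the zonal spherical functions of `M` with respect
to `τ = F ∘ ρ`: for the irreducible components `V_k` of `L²(M, μ)`, the function `x ↦ Φ_k(τ(x,y))` is,
for every pole `y`, the member of `V_k` that depends on the distance to `y` only and takes the value
`1` at `y`; moreover `Φ_k` has degree `k`. -/
def IsZonalFamily (G : Type*) {M : Type*} [MetricSpace M] [MeasurableSpace M]
    [Group G] [MulAction G M] (μ : Measure M) (F : ℝ → ℝ) (Φ : ℕ → Polynomial ℝ) : Prop :=
  ∃ V : ℕ → Submodule ℂ (M → ℂ), IsHarmonicDecomposition G μ (zonalIndex M F) V ∧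
    ∀ k ∈ zonalIndex M F,
      (Φ k).degree = (k : WithBot ℕ) ∧ (Φ k).eval (F 0) = 1 ∧
      ∀ y : M, (fun x : M => (((Φ k).eval (tau F x y) : ℝ) : ℂ)) ∈ V k

/-- A finite set `C` with `τ(x,y) ∈ S` for all distinct `x, y ∈ C`. -/
def IsCode {M : Type*} [MetricSpace M] (F : ℝ → ℝ) (S : Set ℝ) (C : Finset M) : Prop :=
  ∀ x ∈ C, ∀ y ∈ C, x ≠ y → tau F x y ∈ S

/-- `A(M,S)`, the largest cardinality of an `S`-code (`⊤` if there are arbitrarily large ones). -/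
noncomputable def maxCodeSize (M : Type*) [MetricSpace M] (F : ℝ → ℝ) (S : Set ℝ) : ℕ∞ :=
  ⨆ (C : Finset M) (_ : IsCode F S C), (C.card : ℕ∞)

/-- The Hankel matrix `R_m` of `s_0, …, s_{2m-2}`. -/
def hankelR (m : ℕ) (s : ℕ → ℝ) : Matrix (Fin m) (Fin m) ℝ :=
  Matrix.of fun i j => s (i + j)

/-- The matrix `F_m^+(a)`. -/
def hankelPlus (m : ℕ) (s : ℕ → ℝ) (a : ℝ) : Matrix (Fin m) (Fin m) ℝ :=
  Matrix.of fun i j => s (i + j + 1) - a * s (i + j)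

/-- The matrix `F_m^-(b)`. -/
def hankelMinus (m : ℕ) (s : ℕ → ℝ) (b : ℝ) : Matrix (Fin m) (Fin m) ℝ :=
  Matrix.of fun i j => b * s (i + j) - s (i + j + 1)

/-- The block diagonal matrix `H_m(s_0, …, s_{2m-1}, [a,b])`. -/
def hankelH (m : ℕ) (s : ℕ → ℝ) (a b : ℝ) :
    Matrix (Fin m ⊕ (Fin m ⊕ Fin m)) (Fin m ⊕ (Fin m ⊕ Fin m)) ℝ :=
  Matrix.fromBlocks (hankelR m s) 0 0
    (Matrix.fromBlocks (hankelPlus m s a) 0 0 (hankelMinus m s b))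

/-- The sequence `1, x_1, …, x_{2m-1}` (continued by zeros, which are never used); the variable `x_k`
is the entry of `x` with index `k - 1`. -/
def normalizedMoments (m : ℕ) (x : Fin (2 * m - 1) → ℝ) (k : ℕ) : ℝ :=
  if k = 0 then 1 else if h : k - 1 < 2 * m - 1 then x ⟨k - 1, h⟩ else 0

/-- The matrix `H̄_m(x_1, …, x_{2m-1}, [a,b]) = H_m(1, x_1, …, x_{2m-1}, [a,b])`. -/
def hankelHBar (m : ℕ) (x : Fin (2 * m - 1) → ℝ) (a b : ℝ) :
    Matrix (Fin m ⊕ (Fin m ⊕ Fin m)) (Fin m ⊕ (Fin m ⊕ Fin m)) ℝ :=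
  hankelH m (normalizedMoments m x) a b

/-- The constraints of the problem `SDP_0` for given `m`, with `p_{ki}` the coefficients of `Φ_k`; the
linear constraints run over those `k = 1, …, 2m-1` for which `Φ_k` exists, i.e. `k ∈ I`. -/
def IsSDPZeroFeasible (Φ : ℕ → Polynomial ℝ) (I : Set ℕ) (a b : ℝ) (m : ℕ)
    (y : ℝ) (x : Fin (2 * m - 1) → ℝ) : Prop :=
  (∀ k ∈ Finset.Icc 1 (2 * m - 1), k ∈ I →
    y + ∑ i ∈ Finset.Icc 1 k, (Φ k).coeff i * normalizedMoments m x i ≥ -(Φ k).coeff 0) ∧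
  (hankelHBar m x a b).PosSemidef

/-- `y` is the optimal value of the problem `SDP_0` for given `m`: the infimum of the objective over
all feasible points, whether attained or not (so every minimum is included). -/
def IsSDPZeroOptimum (Φ : ℕ → Polynomial ℝ) (I : Set ℕ) (a b : ℝ) (m : ℕ) (y : ℝ) : Prop :=
  IsGLB {z : ℝ | ∃ x : Fin (2 * m - 1) → ℝ, IsSDPZeroFeasible Φ I a b m z x} y

end TwoPointCodes

/-! Let `C` be a code with N ≥ 2 points. The values of τ on its N(N-1) ordered pairs of distinct
points, weighted uniformly, form a probability measure on [a,b], so its moments satisfy the Hankel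
constraints. Positive definiteness of Φ_k gives ΣΣ Φ_k(τ) ≥ 0 over `C`; the diagonal contributes N,
and division by N(N-1) yields the linear constraints with y = 1/(N-1). Hence y* ≤ 1/(N-1), which
rearranges to the bound. Positive definiteness comes from Schur's lemma: the integral operator with
kernel K = Φ_k∘τ is a scalar c on V_k, so ∫ K(x,y)K(z,y) dμ(y) = c K(x,z). Here c > 0, and c ΣΣ K is
the integral of a square. -/

namespace TwoPointCodes

/-! ### Finite interpolation and full support of the invariant measure -/

/-- A finite-dimensional space of functions is cut out by finitely many evaluations: every member is
recovered linearly from its values at finitely many points. -/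
lemma exists_finite_interpolation {M : Type*} (V : Submodule ℂ (M → ℂ)) [Module.Finite ℂ V] :
    ∃ (n : ℕ) (e : Fin n → (M → ℂ)) (c : Fin n → (M →₀ ℂ)), (∀ i, e i ∈ V) ∧
      ∀ f ∈ V, ∀ x, f x = ∑ i, (∑ z ∈ (c i).support, c i z * f z) * e i x := by
  classical
  let ev : M → Module.Dual ℂ V := fun x => (LinearMap.proj x).comp V.subtype
  -- A function at which all evaluations vanish is zero, so evaluations span the dual.
  have hspan : Submodule.span ℂ (Set.range ev) = ⊤ := by
    apply Submodule.span_eq_top_of_ne_zero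
    intro f hf
    by_contra! h
    apply hf
    ext x
    exact h (ev x) ⟨x, rfl⟩
  let B := Module.finBasis ℂ V
  have hc : ∀ i, ∃ c : M →₀ ℂ, c.sum (fun x a => a • ev x) = B.coord i := by
    intro i
    apply Finsupp.mem_span_range_iff_exists_finsupp.1
    rw [hspan]
    trivial
  choose c hc using hc
  refine ⟨_, fun i => (B i : M → ℂ), c, fun i => (B i).2, fun f hf x => ?_⟩
  have h1 := congrArg (fun v : V => (v : M → ℂ) x) (B.sum_repr ⟨f, hf⟩)
  simp only [Submodule.coe_sum, Submodule.coe_smul, Finset.sum_apply, Pi.smul_apply,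
    smul_eq_mul] at h1
  rw [← h1]
  refine Finset.sum_congr rfl fun i _ => ?_
  congr 1
  have h2 := LinearMap.congr_fun (hc i) ⟨f, hf⟩
  rw [Module.Basis.coord_apply] at h2
  rw [← h2]
  simp [Finsupp.sum, LinearMap.sum_apply, ev]

lemma IsTwoPointHomogeneous.continuousConstSMul {M G : Type*} [MetricSpace M] [Group G] [MulAction G M]
    (hM : IsTwoPointHomogeneous G M) :
    ContinuousConstSMul G M :=
  ⟨fun g => (Isometry.of_dist_eq (hM.isometric g)).continuous⟩

lemma IsTwoPointHomogeneous.isMinimal {M G : Type*} [MetricSpace M] [Group G] [MulAction G M]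
    (hM : IsTwoPointHomogeneous G M) :
    MulAction.IsMinimal G M := by
  refine ⟨fun x => ?_⟩
  have : MulAction.orbit G x = Set.univ := by
    refine Set.eq_univ_of_forall fun y => ?_
    obtain ⟨g, hg, -⟩ := hM.homogeneous x x y y (by simp)
    exact ⟨g, hg⟩
  rw [this]
  exact dense_univ

/-- By transitivity and compactness, finitely many translates of a nonempty open set cover the
space. This is what later makes the Schur scalar strictly positive. -/
lemma IsTwoPointHomogeneous.isOpenPosMeasure {M G : Type*} [MetricSpace M]
    [CompactSpace M] [MeasurableSpace M] [Group G] [MulAction G M] (hM : IsTwoPointHomogeneous G M)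
    (μ : Measure M) [IsProbabilityMeasure μ] [SMulInvariantMeasure G M μ] :
    μ.IsOpenPosMeasure := by
  have := hM.continuousConstSMul
  have := hM.isMinimal
  refine ⟨fun U hU hne => ne_of_gt ?_⟩
  exact measure_isOpen_pos_of_smulInvariant_of_compact_ne_zero G (μ := μ) isCompact_univ
    (by simp) hU hne

/-! ### Positive definiteness of zonal kernels -/

section Kernel

variable {M G : Type*} [MetricSpace M] [CompactSpace M] [MeasurableSpace M] [BorelSpace M]
  [Group G] [MulAction G M]

/-- Schur's lemma for the integral operator of an invariant kernel on an irreducible space. -/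
lemma exists_integral_kernel_eq_mul (hM : IsTwoPointHomogeneous G M)
    (μ : Measure M) [IsProbabilityMeasure μ] [SMulInvariantMeasure G M μ]
    (V : Submodule ℂ (M → ℂ)) [Module.Finite ℂ V] (hcont : ∀ f ∈ V, Continuous f)
    (hinv : IsInvariantSpace G V) (hne : V ≠ ⊥)
    (hirr : ∀ W : Submodule ℂ (M → ℂ), W ≤ V → IsInvariantSpace G W → W = ⊥ ∨ W = V)
    (K : M → M → ℂ) (hKV : ∀ y, (fun x => K x y) ∈ V) (hKsymm : ∀ x y, K x y = K y x)
    (hKinv : ∀ (g : G) x y, K (g • x) (g • y) = K x y) :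
    ∃ c : ℂ, ∀ f ∈ V, ∀ x, ∫ y, K x y * f y ∂μ = c * f x := by
  have := hM.continuousConstSMul
  have hKc : ∀ x, Continuous (K x) := fun x => by
    rw [funext (hKsymm x)]
    exact hcont _ (hKV x)
  have hint : ∀ x, ∀ f ∈ V, Integrable (fun y => K x y * f y) μ := fun x f hf =>
    ((hKc x).mul (hcont f hf)).integrable_of_hasCompactSupport
      (HasCompactSupport.of_compactSpace _)
  -- Interpolating K(·,y) at finitely many points separates x from y, so the integral becomes a
  -- finite combination of the `e i`.
  have hmem : ∀ f ∈ V, (fun x => ∫ y, K x y * f y ∂μ) ∈ V := by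
    intro f hf
    obtain ⟨n, e, c, he, hrep⟩ := exists_finite_interpolation V
    have : (fun x => ∫ y, K x y * f y ∂μ) =
        ∑ i, (∑ z ∈ (c i).support, c i z * ∫ y, K z y * f y ∂μ) • e i := by
      funext x
      have h1 : ∀ y, K x y * f y =
          ∑ i, ∑ z ∈ (c i).support, c i z * e i x * (K z y * f y) := by
        intro y
        rw [hrep _ (hKV y) x, Finset.sum_mul]
        refine Finset.sum_congr rfl fun i _ => ?_
        rw [Finset.sum_mul, Finset.sum_mul]
        exact Finset.sum_congr rfl fun z _ => by ring
      simp_rw [h1]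
      rw [integral_finsetSum _ fun i _ => integrable_finsetSum _ fun z _ =>
        (hint z f hf).const_mul _]
      rw [Finset.sum_apply]
      refine Finset.sum_congr rfl fun i _ => ?_
      rw [integral_finsetSum _ fun z _ => (hint z f hf).const_mul _]
      rw [Pi.smul_apply, smul_eq_mul, Finset.sum_mul]
      refine Finset.sum_congr rfl fun z _ => ?_
      rw [integral_const_mul]
      ring
    rw [this]
    exact V.sum_mem fun i _ => V.smul_mem _ (he i)
  let T : Module.End ℂ V :=
    { toFun := fun f => ⟨fun x => ∫ y, K x y * f.1 y ∂μ, hmem f.1 f.2⟩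
      map_add' := fun f g => by
        ext x
        simp only [Submodule.coe_add, Pi.add_apply, mul_add]
        exact integral_add (hint x _ f.2) (hint x _ g.2)
      map_smul' := fun a f => by
        ext x
        simp only [Submodule.coe_smul, Pi.smul_apply, smul_eq_mul, RingHom.id_apply]
        rw [← integral_const_mul]
        exact integral_congr_ae (.of_forall fun y => by ring) }
  have : Nontrivial V := Submodule.nontrivial_iff_ne_bot.2 hne
  obtain ⟨c, hc⟩ := Module.End.exists_eigenvalue T
  have hmemW : ∀ f : M → ℂ, f ∈ (T.eigenspace c).map V.subtype ↔
      f ∈ V ∧ ∀ x, ∫ y, K x y * f y ∂μ = c * f x := by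
    intro f
    rw [Submodule.mem_map]
    constructor
    · rintro ⟨f, hf, rfl⟩
      refine ⟨f.2, fun x => ?_⟩
      rw [Module.End.mem_eigenspace_iff] at hf
      exact congrArg (fun v : V => (v : M → ℂ) x) hf
    · rintro ⟨hf, h⟩
      refine ⟨⟨f, hf⟩, ?_, rfl⟩
      rw [Module.End.mem_eigenspace_iff]
      ext x
      exact h x
  refine ⟨c, ?_⟩
  have hW := hirr ((T.eigenspace c).map V.subtype) (Submodule.map_subtype_le V _) ?_
  · rcases hW with hW | hW
    · refine absurd (Submodule.map_injective_of_injective V.injective_subtype ?_) hc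
      rw [hW, Submodule.map_bot]
    · intro f hf
      rw [← hW] at hf
      exact ((hmemW f).1 hf).2
  · intro g f hf
    rw [hmemW] at hf ⊢
    refine ⟨hinv g f hf.1, fun x => ?_⟩
    -- Substituting y ↦ gy shows that translates of eigenfunctions are eigenfunctions.
    rw [← hf.2 (g • x), ← integral_smul_eq_self (fun y => K (g • x) y * f y) (g := g)]
    simp_rw [hKinv]

/-- A zonal kernel with values in an irreducible invariant space is positive definite. -/
lemma sum_kernel_nonneg (hM : IsTwoPointHomogeneous G M)
    (μ : Measure M) [IsProbabilityMeasure μ] [SMulInvariantMeasure G M μ]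
    (V : Submodule ℂ (M → ℂ)) [Module.Finite ℂ V] (hcont : ∀ f ∈ V, Continuous f)
    (hinv : IsInvariantSpace G V) (hne : V ≠ ⊥)
    (hirr : ∀ W : Submodule ℂ (M → ℂ), W ≤ V → IsInvariantSpace G W → W = ⊥ ∨ W = V)
    (K : M → M → ℝ) (hKV : ∀ y, (fun x => (K x y : ℂ)) ∈ V) (hKsymm : ∀ x y, K x y = K y x)
    (hKinv : ∀ (g : G) x y, K (g • x) (g • y) = K x y) (hKdiag : ∀ x, K x x = 1)
    (C : Finset M) : 0 ≤ ∑ x ∈ C, ∑ z ∈ C, K x z := by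
  have := hM.isOpenPosMeasure μ
  obtain ⟨c, hc⟩ := exists_integral_kernel_eq_mul hM μ V hcont hinv hne hirr
    (fun x y => (K x y : ℂ)) hKV (fun x y => by rw [hKsymm]) (fun g x y => by rw [hKinv])
  have hKc : ∀ x, Continuous (K x) := fun x => by
    have h1 := Complex.continuous_re.comp (hcont _ (hKV x))
    have h2 : K x = Complex.re ∘ fun y => (K y x : ℂ) := by
      funext y
      simp [hKsymm x y]
    rw [h2]
    exact h1
  have hint : ∀ x z, Integrable (fun y => K x y * K z y) μ := fun x z =>
    ((hKc x).mul (hKc z)).integrable_of_hasCompactSupport (HasCompactSupport.of_compactSpace _)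
  have hc' : ∀ x z, ((∫ y, K x y * K z y ∂μ : ℝ) : ℂ) = c * (K x z : ℂ) := fun x z => by
    rw [← hc _ (hKV z) x, ← integral_complex_ofReal]
    refine integral_congr_ae (.of_forall fun y => ?_)
    simp [hKsymm z y]
  have hcre : ∀ x z, ∫ y, K x y * K z y ∂μ = c.re * K x z := fun x z => by
    have := congrArg Complex.re (hc' x z)
    simpa using this
  rcases C.eq_empty_or_nonempty with rfl | ⟨x₀, -⟩
  · simp
  -- The scalar equals ∫ K(x₀,y)² dμ(y), whose continuous integrand is 1 at y = x₀.
  have hpos : 0 < c.re := by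
    have h1 := hcre x₀ x₀
    rw [hKdiag, mul_one] at h1
    rw [← h1]
    exact ((hKc x₀).mul (hKc x₀)).integral_pos_of_hasCompactSupport_nonneg_nonzero
      (HasCompactSupport.of_compactSpace _) (fun y => mul_self_nonneg _)
      (x := x₀) (by simp [hKdiag])
  have hsq : c.re * ∑ x ∈ C, ∑ z ∈ C, K x z = ∫ y, (∑ x ∈ C, K x y) * (∑ z ∈ C, K z y) ∂μ := by
    simp_rw [Finset.sum_mul_sum]
    rw [integral_finsetSum _ fun x _ => integrable_finsetSum _ fun z _ => hint x z,
      Finset.mul_sum]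
    refine Finset.sum_congr rfl fun x _ => ?_
    rw [integral_finsetSum _ fun z _ => hint x z, Finset.mul_sum]
    exact Finset.sum_congr rfl fun z _ => (hcre x z).symm
  refine nonneg_of_mul_nonneg_right (a := c.re) ?_ hpos
  rw [hsq]
  exact integral_nonneg fun y => mul_self_nonneg _

/-- Zonal spherical functions are positive definite. -/
lemma IsZonalFamily.sum_eval_tau_nonneg (hM : IsTwoPointHomogeneous G M)
    {μ : Measure M} [IsProbabilityMeasure μ] [SMulInvariantMeasure G M μ]
    {F : ℝ → ℝ} {Φ : ℕ → Polynomial ℝ} (hΦ : IsZonalFamily G μ F Φ)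
    {k : ℕ} (hk : k ∈ zonalIndex M F) (C : Finset M) :
    0 ≤ ∑ x ∈ C, ∑ z ∈ C, (Φ k).eval (tau F x z) := by
  obtain ⟨V, hV, hΦ⟩ := hΦ
  obtain ⟨-, h1, hmem⟩ := hΦ k hk
  have := hV.finite k hk
  exact sum_kernel_nonneg hM μ (V k) (hV.continuous k hk) (hV.invariant k hk)
    (hV.nontrivial k hk) (hV.irreducible k hk) (fun x z => (Φ k).eval (tau F x z)) hmem
    (fun x y => by simp only [tau, dist_comm]) (fun g x y => by simp only [tau, hM.isometric])
    (fun x => by simpa [tau] using h1) C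

end Kernel

/-! ### Moments and the semidefinite program -/

lemma posSemidef_fromBlocks_zero {m n : Type*} [Fintype m] [Fintype n]
    {A : Matrix m m ℝ} {D : Matrix n n ℝ} (hA : A.PosSemidef) (hD : D.PosSemidef) :
    (Matrix.fromBlocks A 0 0 D).PosSemidef := by
  refine Matrix.PosSemidef.of_dotProduct_mulVec_nonneg ?_ fun v => ?_
  · exact hA.isHermitian.fromBlocks (by simp) hD.isHermitian
  · rw [Matrix.fromBlocks_mulVec]
    have h1 := hA.dotProduct_mulVec_nonneg (v ∘ Sum.inl)
    have h2 := hD.dotProduct_mulVec_nonneg (v ∘ Sum.inr)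
    simp only [dotProduct, Fintype.sum_sum_type, Sum.elim_inl, Sum.elim_inr, Matrix.zero_mulVec,
      add_zero, zero_add, Pi.star_apply, Function.comp_apply] at h1 h2 ⊢
    exact add_nonneg h1 h2

/-- Each atom contributes a nonnegative multiple of the rank-one matrix v vᵀ with v = (1, t, t², …).
-/
lemma posSemidef_hankel_of_nonneg {ι : Type*} (P : Finset ι) (w t : ι → ℝ)
    (hw : ∀ p ∈ P, 0 ≤ w p) (m : ℕ) :
    (hankelR m fun k => ∑ p ∈ P, w p * t p ^ k).PosSemidef := by
  have : (hankelR m fun k => ∑ p ∈ P, w p * t p ^ k) =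
      ∑ p ∈ P, w p • Matrix.vecMulVec (fun i : Fin m => t p ^ (i : ℕ))
        (star fun i : Fin m => t p ^ (i : ℕ)) := by
    ext i j
    simp [hankelR, Matrix.sum_apply, Matrix.vecMulVec_apply, pow_add]
  rw [this]
  exact Matrix.posSemidef_sum _ fun p hp =>
    (Matrix.posSemidef_vecMulVec_self_star _).smul (hw p hp)

/-- Moments of a finite positive measure on `[a, b]` satisfy the Hankel constraints. -/
lemma posSemidef_hankelH_of_moments {ι : Type*} (P : Finset ι) (w t : ι → ℝ)
    (hw : ∀ p ∈ P, 0 ≤ w p) {a b : ℝ} (ht : ∀ p ∈ P, t p ∈ Set.Icc a b) (m : ℕ) :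
    (hankelH m (fun k => ∑ p ∈ P, w p * t p ^ k) a b).PosSemidef := by
  refine posSemidef_fromBlocks_zero (posSemidef_hankel_of_nonneg P w t hw m)
    (posSemidef_fromBlocks_zero ?_ ?_)
  -- The localizing block is the Hankel matrix of the reweighted measure (t - a) dw, nonnegative on
  -- [a,b].
  · convert posSemidef_hankel_of_nonneg P (fun p => w p * (t p - a)) t
      (fun p hp => mul_nonneg (hw p hp) (sub_nonneg.2 (ht p hp).1)) m using 1
    ext i j
    simp only [hankelPlus, hankelR, Matrix.of_apply]
    rw [Finset.mul_sum, ← Finset.sum_sub_distrib]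
    exact Finset.sum_congr rfl fun p _ => by ring
  · convert posSemidef_hankel_of_nonneg P (fun p => w p * (b - t p)) t
      (fun p hp => mul_nonneg (hw p hp) (sub_nonneg.2 (ht p hp).2)) m using 1
    ext i j
    simp only [hankelMinus, hankelR, Matrix.of_apply]
    rw [Finset.mul_sum, ← Finset.sum_sub_distrib]
    exact Finset.sum_congr rfl fun p _ => by ring

lemma normalizedMoments_of_lt {m : ℕ} {s : ℕ → ℝ} (h0 : s 0 = 1) {k : ℕ} (hk : k < 2 * m) :
    normalizedMoments m (fun i => s (i + 1)) k = s k := by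
  unfold normalizedMoments
  split_ifs with h1 h2
  · rw [h1, h0]
  · exact congrArg s (by simp only; omega)
  · omega

/-- The largest index read is 2(m-1)+1 = 2m-1, so the padding zeros never enter. -/
lemma hankelH_congr {m : ℕ} {s s' : ℕ → ℝ} (h : ∀ k < 2 * m, s k = s' k) (a b : ℝ) :
    hankelH m s a b = hankelH m s' a b := by
  have h1 : ∀ i j : Fin m, s (i + j) = s' (i + j) := fun i j => h _ (by omega)
  have h2 : ∀ i j : Fin m, s (i + j + 1) = s' (i + j + 1) := fun i j => h _ (by omega)
  simp only [hankelH, hankelR, hankelPlus, hankelMinus, h1, h2]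

/-- A code with at least two points gives a feasible point of `SDP_0`, formed by the moments of its
distance distribution. -/
lemma exists_isSDPZeroFeasible_of_isCode {M : Type*} [MetricSpace M] {F : ℝ → ℝ}
    {Φ : ℕ → Polynomial ℝ} {I : Set ℕ} {a b : ℝ} {S : Set ℝ} (hS : S ⊆ Set.Icc a b) (m : ℕ)
    (hdeg : ∀ k ∈ I, (Φ k).natDegree = k) (hone : ∀ k ∈ I, (Φ k).eval (F 0) = 1)
    {C : Finset M} (hC : IsCode F S C) (hcard : 1 < C.card)
    (hpos : ∀ k ∈ I, 0 ≤ ∑ x ∈ C, ∑ z ∈ C, (Φ k).eval (tau F x z)) :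
    ∃ x, IsSDPZeroFeasible Φ I a b m ((C.card - 1 : ℝ)⁻¹) x := by
  classical
  set N : ℝ := (C.card : ℝ) with hN
  have hN1 : 1 < N := by rw [hN]; exact_mod_cast hcard
  have hN0 : 0 < N := by linarith
  have hN2 : 0 < N - 1 := by linarith
  set w : ℝ := (N * (N - 1))⁻¹ with hw
  have hw0 : 0 < w := by positivity
  let t : M × M → ℝ := fun p => tau F p.1 p.2
  let s : ℕ → ℝ := fun k => ∑ p ∈ C.offDiag, w * t p ^ k
  have hs0 : s 0 = 1 := by
    simp only [s, pow_zero, mul_one, Finset.sum_const, Finset.offDiag_card, nsmul_eq_mul]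
    rw [Nat.cast_sub (Nat.le_mul_self _), Nat.cast_mul, ← hN, hw]
    field_simp
  have hmom : ∀ k < 2 * m, normalizedMoments m (fun i => s (i + 1)) k = s k := fun k hk =>
    normalizedMoments_of_lt hs0 hk
  refine ⟨fun i => s (i + 1), fun k hk hkI => ?_, ?_⟩
  · rw [Finset.mem_Icc] at hk
    have hsum : ∑ i ∈ Finset.Icc 1 k, (Φ k).coeff i * normalizedMoments m (fun i => s (i + 1)) i
        = (∑ p ∈ C.offDiag, w * (Φ k).eval (t p)) - (Φ k).coeff 0 := by
      have h1 : ∑ i ∈ Finset.Icc 1 k,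
            (Φ k).coeff i * normalizedMoments m (fun i => s (i + 1)) i =
          ∑ i ∈ Finset.Icc 1 k, (Φ k).coeff i * s i :=
        Finset.sum_congr rfl fun i hi => by
          rw [Finset.mem_Icc] at hi
          rw [hmom i (by omega)]
      have h2 : ∑ p ∈ C.offDiag, w * (Φ k).eval (t p) =
          ∑ i ∈ Finset.range (k + 1), (Φ k).coeff i * s i := by
        simp only [s, Polynomial.eval_eq_sum_range, hdeg k hkI, Finset.mul_sum]
        rw [Finset.sum_comm]
        exact Finset.sum_congr rfl fun i _ => Finset.sum_congr rfl fun p _ => by ring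
      rw [h1, h2, Finset.sum_range_succ', hs0, mul_one, add_sub_cancel_right,
        ← Finset.Ico_add_one_right_eq_Icc, Finset.sum_Ico_eq_sum_range]
      simp [add_comm]
    have hsplit : ∑ x ∈ C, ∑ z ∈ C, (Φ k).eval (tau F x z) =
        N + ∑ p ∈ C.offDiag, (Φ k).eval (t p) := by
      rw [← Finset.sum_product' C C fun x z => (Φ k).eval (tau F x z), ← Finset.diag_union_offDiag,
        Finset.sum_union (Finset.disjoint_diag_offDiag C), Finset.sum_diag]
      simp [tau, hone k hkI, hN, t]
    have hkpos := hpos k hkI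
    rw [hsplit] at hkpos
    have hfin : 0 ≤ (N - 1)⁻¹ + ∑ p ∈ C.offDiag, w * (Φ k).eval (t p) := by
      have : (N - 1)⁻¹ + ∑ p ∈ C.offDiag, w * (Φ k).eval (t p) =
          w * (N + ∑ p ∈ C.offDiag, (Φ k).eval (t p)) := by
        rw [mul_add, Finset.mul_sum, hw]
        congr 1
        field_simp
      rw [this]
      exact mul_nonneg hw0.le hkpos
    rw [hsum]
    linarith
  · rw [hankelHBar, hankelH_congr hmom]
    refine posSemidef_hankelH_of_moments _ _ t (fun _ _ => hw0.le) (fun p hp => ?_) m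
    rw [Finset.mem_offDiag] at hp
    exact hS (hC _ hp.1 _ hp.2.1 hp.2.2)

end TwoPointCodes

theorem theorem4p1 {M G : Type*} [MetricSpace M] [CompactSpace M] [MeasurableSpace M]
    [BorelSpace M] [Group G] [MulAction G M]
    (hM : TwoPointCodes.IsTwoPointHomogeneous G M)
    (μ : Measure M) [IsProbabilityMeasure μ] [SMulInvariantMeasure G M μ]
    (F : ℝ → ℝ) (Φ : ℕ → Polynomial ℝ) (hΦ : TwoPointCodes.IsZonalFamily G μ F Φ)
    (a b : ℝ) (m : ℕ) (hm : 1 ≤ m) (yopt : ℝ)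
    (hy : TwoPointCodes.IsSDPZeroOptimum Φ (TwoPointCodes.zonalIndex M F) a b m yopt)
    (hpos : 0 < yopt) :
    (TwoPointCodes.maxCodeSize M F (TwoPointCodes.tauRange M F ∩ Set.Icc a b) : ℝ≥0∞) ≤
      ENNReal.ofReal ((1 + yopt) / yopt) := by

  rw [TwoPointCodes.maxCodeSize]
  have hbound : ∀ C : Finset M,
      TwoPointCodes.IsCode F (TwoPointCodes.tauRange M F ∩ Set.Icc a b) C →
      (C.card : ℝ) ≤ (1 + yopt) / yopt := by
    intro C hC
    rw [le_div_iff₀ hpos]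
    -- With at most one point there is no distance distribution, but the bound exceeds 1 anyway.
    rcases le_or_gt C.card 1 with h | h
    · have : (C.card : ℝ) ≤ 1 := by exact_mod_cast h
      nlinarith
    · have hcode := TwoPointCodes.exists_isSDPZeroFeasible_of_isCode
        (I := TwoPointCodes.zonalIndex M F) Set.inter_subset_right m
        (fun k hk => by
          obtain ⟨V, -, hV⟩ := hΦ
          exact Polynomial.natDegree_eq_of_degree_eq_some (hV k hk).1)
        (fun k hk => by
          obtain ⟨V, -, hV⟩ := hΦ
          exact (hV k hk).2.1)
        hC h (fun k hk => hΦ.sum_eval_tau_nonneg hM hk C)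
      have hle := hy.1 hcode
      have h1 : (0 : ℝ) < C.card - 1 := by
        have : (1 : ℝ) < C.card := by exact_mod_cast h
        linarith
      rw [le_inv_comm₀ hpos h1, ← one_div, le_div_iff₀ hpos] at hle
      linarith
  -- Rounding down gives a natural-number bound for the supremum, which is therefore finite.
  have hnat : ((⨆ (C : Finset M)
      (_ : TwoPointCodes.IsCode F (TwoPointCodes.tauRange M F ∩ Set.Icc a b) C),
      (C.card : ℕ∞)) : ℕ∞) ≤ (⌊(1 + yopt) / yopt⌋₊ : ℕ) :=
    iSup₂_le fun C hC => by exact_mod_cast Nat.le_floor (hbound C hC)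
  calc _ ≤ (((⌊(1 + yopt) / yopt⌋₊ : ℕ) : ℕ∞) : ℝ≥0∞) := ENat.toENNReal_le.2 hnat
    _ = ENNReal.ofReal (⌊(1 + yopt) / yopt⌋₊ : ℝ) := by simp
    _ ≤ _ := ENNReal.ofReal_le_ofReal (Nat.floor_le (by positivity))
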